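/- **Setting.** Let $G=(V,E)$ be a finite undirected graph with $n=|V|\ge 3$ vertices and positive real edge weights. Write $|P|$ for the weighted length of a path $P$, $P[x,y]$ for its part from $x$ to $y$, and $\delta_{G'}(x,y)\in[0,\infty]$ for the distance in a subgraph $G'$. For $R\subseteq V$ let $G-R$ be the subgraph induced by $V\setminus R$. Put $k=\ln n$, let $d\ge 2$ be an integer, let $c\ge 1$ be real, and let $\sigma=4e\,d^{c+1}\ln^2 n+1$. **Tree covers.** For all $R,S\subseteq V$ let $\mathcal T_R(S)$ be an $(S\setminus R)$-restricted tree cover of $G-R$. This is a family of rooted trees $\{T(r): r\in S\setminus R\}$ that are subgraphs of $G-R$, with $T(r)$ rooted at $r$, such that - for all $a\in S\setminus R$ and $b\in V\setminus R$ that are connected in $G-R$ there is $r\in S\setminus R$ with $a,b\in V(T(r))$ and $\mathrm{dep}_{T(r)}(a)+\mathrm{dep}_{T(r)}(b)\le(2k-1)\,\delta_{G-R}(a,b)$, where $\mathrm{dep}_T(x)$ is the weighted distance in $T$ from $x$ to the root; - every vertex of $G-R$ is in at most $2e\ln^2 n$ of the trees. The trunk vertices of $T\in\mathcal T_R(S)$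 are the vertices on tree paths between two vertices of $S\setminus R$ in $T$. The pseudo-degree of $v$ in $T$ is its degree in the subgraph of $T$ induced by the trunk vertices ($0$ if $v$ is not a trunk vertex). $\mathrm{Hi}(\mathcal T_R(S))$ is the set of vertices that have pseudo-degree $>\sigma$ in some tree of $\mathcal T_R(S)$. **Hierarchy and levels.** The hierarchy tree is the rooted tree whose nodes are subsets of $V$, with root $V$. A node $A$ is a leaf if $\mathrm{Hi}(\mathcal T_\varnothing(A))=\varnothing$; otherwise its children are $W_1,\dots,W_d$, where $W_0=\varnothing$ and $W_{j+1}=W_j\cup\mathrm{Hi}(\mathcal T_{W_j}(A))$. Let $V=U_1,U_2,\dots,U_p$ ($p\ge1$) be any path in this tree that starts at the root and goes from each node to one of its children, and put $U_{p+1}=\varnothing$. The level of a vertex $v$ is the largest $l\le p$ with $v\in U_l$, and $G_i$ is the subgraph of $G$ induced by the vertices of level at most $i$. **The set $V(H)$.** Let $D\subseteq V$ with $|D|\le d$, and let $s,t\in V\setminus D$. For $f\in D$ let $N(f)$ consist of, for every tree $T\in\bigcup_{i=1}^p\mathcal T_{U_{i+1}}(U_i)$ that contains $f$, the parent of $f$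 in $T$ (if $f$ is not the root) and all children of $f$ in $T$ that are trunk vertices of $T$. Let $V(H)=\bigl(\{s,t\}\cup\bigcup_{f\in D}N(f)\bigr)\setminus D$. **Far paths and segments.** Let $P$ be a path from $u$ to $v$ and let $\eta>0$. - $P$ is $\eta$-far from $V(H)$ if there are no vertices $x\in P\setminus\{u,v\}$ and $w\in V(H)$ with $\delta_{G-D}(x,w)\le\eta\cdot\min\{|P[u,x]|,|P[x,v]|\}$. - Two vertices $x,y\in P\setminus\{u,v\}$ are in the same $\eta$-segment of $P$ if either $|P[u,x]|,|P[u,y]|\le|P|/2$ and $\lfloor\log_{1+\eta}|P[u,x]|\rfloor=\lfloor\log_{1+\eta}|P[u,y]|\rfloor$, or $|P[x,v]|,|P[y,v]|<|P|/2$ and $\lfloor\log_{1+\eta}|P[x,v]|\rfloor=\lfloor\log_{1+\eta}|P[y,v]|\rfloor$. The $\eta$-segments of $P$ are the subpaths $P[x,y]$ from the first to the last vertex of an equivalence class. - $P$ is an $\eta$-segment expath if for each of its $\eta$-segments $P[x,y]$ there is $1\le i\le p$ such that $P[x,y]$ is a shortest path in $G_i$. **Theorem.** Let $\epsilon>0$,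 $u,v\in V(H)$, $\epsilon_3=\epsilon/(2|V(H)|)$ and $\epsilon_4=\epsilon_3/(4k-2)$. Let $P=\pi_{G-D}(u,v)$ be a shortest path from $u$ to $v$ in $G-D$. If $P$ is $\epsilon_3$-far from $V(H)$, then $P$ is an $\epsilon_4$-segment expath. -/

import Mathlib

open scoped ENNReal

namespace VSDO

noncomputable section

/-- Weighted length `|p|` of a walk, for edge weights `wt`. -/
def wlen {V : Type*} {G : SimpleGraph V} (wt : Sym2 V → ℝ) {x y : V} (p : G.Walk x y) : ℝ :=
  (p.edges.map wt).sum

/-- The walk `p` stays inside the induced subgraph `G[A]`. -/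
def StaysIn {V : Type*} {G : SimpleGraph V} (A : Set V) {x y : V} (p : G.Walk x y) : Prop :=
  ∀ z ∈ p.support, z ∈ A

/-- Weighted distance from `x` to `y` in the induced subgraph `G[A]`
(`⊤` if `x`, `y` are not connected in `G[A]`, in particular if one of them is not in `A`). -/
def wdist {V : Type*} (G : SimpleGraph V) (wt : Sym2 V → ℝ) (A : Set V) (x y : V) : ℝ≥0∞ :=
  ⨅ p : {p : G.Walk x y // StaysIn A p}, ENNReal.ofReal (wlen wt p.1)

/-- `p` is a shortest path in the induced subgraph `G[A]`. (Weights are positive, so it makes no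
difference whether `p` is compared with all paths or with all walks of `G[A]`.) -/
def IsShortestPathIn {V : Type*} {G : SimpleGraph V} (wt : Sym2 V → ℝ) (A : Set V) {x y : V}
    (p : G.Walk x y) : Prop :=
  p.IsPath ∧ StaysIn A p ∧ ∀ q : G.Walk x y, StaysIn A q → wlen wt p ≤ wlen wt q

/-! Rooted trees. A tree on a subset of `V` with root `r` is stored as a graph `T` on `V`, all of
whose edges lie in the connected component of `r`; its vertex set is that component. -/

/-- The vertex set `V(T)` of the tree `T` with root `r`. -/
def treeVerts {V : Type*} (T : SimpleGraph V) (r : V) : Set V := {v | T.Reachable r v}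

/-- `T` is a tree with root `r`, contained in the induced subgraph `G[A]`. -/
structure IsRootedTreeIn {V : Type*} (G : SimpleGraph V) (A : Set V) (T : SimpleGraph V) (r : V) : Prop where
  le : T ≤ G
  acyclic : T.IsAcyclic
  mem_of_adj : ∀ x y, T.Adj x y → x ∈ treeVerts T r
  verts_subset : treeVerts T r ⊆ A

/-- Weighted depth of `x` in the tree `T` with root `r` (`⊤` if `x` is not in the tree). -/
def depth {V : Type*} (wt : Sym2 V → ℝ) (T : SimpleGraph V) (r x : V) : ℝ≥0∞ :=
  wdist T wt Set.univ x r

/-- In the tree `T` with root `r`, the vertex `a` is the parent of `b`: it is the neighbour of `b`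
on the tree path from the root to `b`. -/
def IsParent {V : Type*} (T : SimpleGraph V) (r a b : V) : Prop :=
  T.Adj a b ∧ ∃ q : T.Walk r b, q.IsPath ∧ a ∈ q.support

/-- The trunk vertices of the tree `T` with root `r`, relative to the source set `S`:
the vertices that lie on the tree path between two vertices of `S`. -/
def trunk {V : Type*} (S : Set V) (T : SimpleGraph V) (r : V) : Set V :=
  {v | v ∈ treeVerts T r ∧
    ∃ a ∈ S, ∃ b ∈ S, ∃ q : T.Walk a b, q.IsPath ∧ v ∈ q.support}

/-- Pseudo-degree: the degree of `v` in the subgraph of `T` induced by the trunk vertices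
(`0` if `v` is not a trunk vertex). -/
def pdeg {V : Type*} (S : Set V) (T : SimpleGraph V) (r v : V) : ℕ :=
  {x | v ∈ trunk S T r ∧ x ∈ trunk S T r ∧ T.Adj v x}.ncard

/-- The parameter `k = ln n`, where `n` is the number of vertices. -/
def kpar (V : Type*) [Fintype V] : ℝ := Real.log (Fintype.card V)

/-- `𝒯_R(S)`: an `(S \ R)`-restricted tree cover of the graph `G - R`. There is one tree for each
root `r ∈ S \ R`; the values of `tree` at other vertices are irrelevant. -/
structure TreeCover {V : Type*} [Fintype V] (G : SimpleGraph V) (wt : Sym2 V → ℝ) (R S : Set V) where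
  tree : V → SimpleGraph V
  isTree : ∀ r ∈ S \ R, IsRootedTreeIn G Rᶜ (tree r) r
  stretch : ∀ a ∈ S \ R, ∀ b ∈ Rᶜ, wdist G wt Rᶜ a b < ⊤ →
    ∃ r ∈ S \ R, a ∈ treeVerts (tree r) r ∧ b ∈ treeVerts (tree r) r ∧
      depth wt (tree r) r a + depth wt (tree r) r b
        ≤ ENNReal.ofReal (2 * kpar V - 1) * wdist G wt Rᶜ a b
  overlap : ∀ v ∈ Rᶜ, ({r | r ∈ S \ R ∧ v ∈ treeVerts (tree r) r}.ncard : ℝ)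
    ≤ 2 * Real.exp 1 * (Real.log (Fintype.card V)) ^ 2

/-- The degree threshold `4e d^(c+1) ln² n + 1`. -/
def degThreshold (V : Type*) [Fintype V] (d : ℕ) (c : ℝ) : ℝ :=
  4 * Real.exp 1 * (d : ℝ) ^ (c + 1) * (Real.log (Fintype.card V)) ^ 2 + 1

/-- `Hi(𝒯_R(S))`: vertices whose pseudo-degree exceeds the threshold in some tree of the cover. -/
def Hi {V : Type*} [Fintype V] {G : SimpleGraph V} {wt : Sym2 V → ℝ}
    (d : ℕ) (c : ℝ) {R S : Set V} (C : TreeCover G wt R S) : Set V :=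
  {v | ∃ r ∈ S \ R, v ∈ treeVerts (C.tree r) r ∧
    degThreshold V d c < (pdeg (S \ R) (C.tree r) r v : ℝ)}

/-- The sets `W_0 = ∅`, `W_{j+1} = W_j ∪ Hi(𝒯_{W_j}(A))`. The children of a non-leaf node `A` of
the hierarchy tree are `W_1, …, W_d`; note that `W_1 = Hi(𝒯_∅(A)) = Hi(𝒯(A))`. -/
def childSet {V : Type*} [Fintype V] {G : SimpleGraph V} {wt : Sym2 V → ℝ}
    (𝒯 : ∀ R S : Set V, TreeCover G wt R S) (d : ℕ) (c : ℝ) (A : Set V) : ℕ → Set V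
  | 0 => ∅
  | j + 1 => childSet 𝒯 d c A j ∪ Hi d c (𝒯 (childSet 𝒯 d c A j) A)

/-- `U 1, …, U p` is a path in the hierarchy tree that starts at the root `V`; moreover
`U (p+1) = ∅` by convention. (Other values of `U` are irrelevant.)
A node is a leaf if and only if `Hi` of its tree cover is empty. -/
structure IsHierarchyPath {V : Type*} [Fintype V] {G : SimpleGraph V} {wt : Sym2 V → ℝ}
    (𝒯 : ∀ R S : Set V, TreeCover G wt R S) (d : ℕ) (c : ℝ)
    (U : ℕ → Set V) (p : ℕ) : Prop where
  one_le : 1 ≤ p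
  root : U 1 = Set.univ
  child : ∀ i, 1 ≤ i → i < p → (Hi d c (𝒯 ∅ (U i))).Nonempty ∧
    ∃ j, 1 ≤ j ∧ j ≤ d ∧ U (i + 1) = childSet 𝒯 d c (U i) j
  last : U (p + 1) = ∅

open Classical in
/-- The level of `v`: the largest `l ≤ p` with `v ∈ U l` (it is at least `1` because
`U 1` contains all vertices). -/
def level {V : Type*} (U : ℕ → Set V) (p : ℕ) (v : V) : ℕ :=
  Nat.findGreatest (fun l => v ∈ U l) p

/-- The vertex set of the graph `G_i`: all vertices of level at most `i`. -/
def levelSet {V : Type*} (U : ℕ → Set V) (p i : ℕ) : Set V := {v | level U p v ≤ i}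

/-- `N(f)`: over all trees `T` in `⋃_{1 ≤ i ≤ p} 𝒯_{U_{i+1}}(U_i)` that contain `f`,
the parent of `f` in `T` (if `f` is not the root of `T`) and those children of `f` in `T` that are
trunk vertices of `T`. -/
def failNbrs {V : Type*} [Fintype V] {G : SimpleGraph V} {wt : Sym2 V → ℝ}
    (𝒯 : ∀ R S : Set V, TreeCover G wt R S) (U : ℕ → Set V) (p : ℕ) (f : V) : Set V :=
  {x | ∃ i, 1 ≤ i ∧ i ≤ p ∧ ∃ r ∈ U i \ U (i + 1),
    f ∈ treeVerts ((𝒯 (U (i + 1)) (U i)).tree r) r ∧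
    (IsParent ((𝒯 (U (i + 1)) (U i)).tree r) r x f ∨
      (IsParent ((𝒯 (U (i + 1)) (U i)).tree r) r f x ∧
        x ∈ trunk (U i \ U (i + 1)) ((𝒯 (U (i + 1)) (U i)).tree r) r))}

/-- The vertex set `V(H)` of the auxiliary graph for the query `(s, t, D)`. -/
def auxVerts {V : Type*} [Fintype V] {G : SimpleGraph V} {wt : Sym2 V → ℝ}
    (𝒯 : ∀ R S : Set V, TreeCover G wt R S) (U : ℕ → Set V) (p : ℕ)
    (D : Set V) (s t : V) : Set V :=
  ({s, t} ∪ ⋃ f ∈ D, failNbrs 𝒯 U p f) \ D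

/-- The walk `P` from `u` to `v` is `ε`-far away from the vertex set `N`, where distances to `N`
are measured in `G - D`. -/
def IsFar {V : Type*} {G : SimpleGraph V}
    (wt : Sym2 V → ℝ) (D : Set V) (ε : ℝ) (N : Set V) {u v : V} (P : G.Walk u v) : Prop :=
  ¬ ∃ i, 1 ≤ i ∧ i < P.length ∧ ∃ w ∈ N, wdist G wt Dᶜ (P.getVert i) w
    ≤ ENNReal.ofReal (ε * min (wlen wt (P.take i)) (wlen wt (P.drop i)))

/-- The `i`-th and the `j`-th vertex of `P` are interior and lie in the same `ε`-segment. -/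
def SameSegment {V : Type*} {G : SimpleGraph V}
    (wt : Sym2 V → ℝ) (ε : ℝ) {u v : V} (P : G.Walk u v) (i j : ℕ) : Prop :=
  1 ≤ i ∧ i < P.length ∧ 1 ≤ j ∧ j < P.length ∧
  ((wlen wt (P.take i) ≤ wlen wt P / 2 ∧ wlen wt (P.take j) ≤ wlen wt P / 2 ∧
      ⌊Real.logb (1 + ε) (wlen wt (P.take i))⌋ = ⌊Real.logb (1 + ε) (wlen wt (P.take j))⌋) ∨
   (wlen wt (P.drop i) < wlen wt P / 2 ∧ wlen wt (P.drop j) < wlen wt P / 2 ∧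
      ⌊Real.logb (1 + ε) (wlen wt (P.drop i))⌋ = ⌊Real.logb (1 + ε) (wlen wt (P.drop j))⌋))

/-- The `a`-th vertex of `P` is the leftmost and the `b`-th vertex is the rightmost vertex of one
and the same `ε`-segment of `P`. -/
def IsSegment {V : Type*} {G : SimpleGraph V}
    (wt : Sym2 V → ℝ) (ε : ℝ) {u v : V} (P : G.Walk u v) (a b : ℕ) : Prop :=
  SameSegment wt ε P a b ∧ ∀ j, SameSegment wt ε P a j → a ≤ j ∧ j ≤ b

/-- `P` is an `ε`-segment expath: a path in `G` each of whose `ε`-segments is a shortest path in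
some `G_i`, `1 ≤ i ≤ p`. -/
def IsSegmentExpath {V : Type*} {G : SimpleGraph V}
    (wt : Sym2 V → ℝ) (U : ℕ → Set V) (p : ℕ) (ε : ℝ) {u v : V}
    (P : G.Walk u v) : Prop :=
  P.IsPath ∧ ∀ a b, IsSegment wt ε P a b →
    ∃ i, 1 ≤ i ∧ i ≤ p ∧ IsShortestPathIn wt (levelSet U p i) ((P.drop a).take (b - a))

end

end VSDO

/-! Let `z` be a vertex of maximal level `i` on a segment, so the segment lies in `G_i`. If some
walk in `G_i` with the same ends were shorter, it would meet `D` at some `f`, since `P` is shortest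
in `G - D`. The segment and this walk together join `z` to `f` inside `G_i` by a walk no longer than
the segment (`exists_walk_le_of_shorter`). Since `z ∈ U i \ U (i+1)` and `G_i` avoids `U (i+1)`, the
cover `𝒯 (U (i+1)) (U i)` has a tree whose route from `z` via the root to `f` is at most `2k - 1`
times as long. The last vertex of this route before it first enters `D` lies in `V(H)`
(`exists_auxVert_near`). As a segment is at most `ε₄` times as long as the distance along `P` from
`z` to the nearer end (`SameSegment.wlen_le`), this contradicts farness. -/

namespace VSDO

open SimpleGraph

/-! ### Lengths of walks, splitting and rerouting -/

section WalkLength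

variable {V : Type*} {G : SimpleGraph V} {wt : Sym2 V → ℝ}

@[simp]
lemma wlen_append {x y z : V} (p : G.Walk x y) (q : G.Walk y z) :
    wlen wt (p.append q) = wlen wt p + wlen wt q := by
  simp [wlen]

@[simp]
lemma wlen_reverse {x y : V} (p : G.Walk x y) : wlen wt p.reverse = wlen wt p := by
  simp [wlen, Walk.edges_reverse, List.map_reverse]

@[simp]
lemma wlen_mapLe {T : SimpleGraph V} (h : T ≤ G) {x y : V} (p : T.Walk x y) :
    wlen wt (p.mapLe h) = wlen wt p := by
  simp [wlen]

lemma wlen_cons {x y z : V} (h : G.Adj x y) (p : G.Walk y z) :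
    wlen wt (Walk.cons h p) = wt s(x, y) + wlen wt p := by
  simp [wlen]

lemma wlen_nonneg (hwt : ∀ e ∈ G.edgeSet, 0 < wt e) {x y : V} (p : G.Walk x y) :
    0 ≤ wlen wt p := by
  refine List.sum_nonneg fun a ha => ?_
  obtain ⟨e, he, rfl⟩ := List.mem_map.1 ha
  exact (hwt e (p.edges_subset_edgeSet he)).le

lemma wlen_pos (hwt : ∀ e ∈ G.edgeSet, 0 < wt e) {x y : V} (p : G.Walk x y)
    (hp : 0 < p.length) : 0 < wlen wt p := by
  cases p with
  | nil => simp at hp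
  | cons h q =>
    rw [wlen_cons]
    have := wlen_nonneg hwt q
    have := hwt _ ((G.mem_edgeSet).2 h)
    linarith

lemma wlen_bypass_le [DecidableEq V] (hwt : ∀ e ∈ G.edgeSet, 0 < wt e) {x y : V}
    (p : G.Walk x y) : wlen wt p.bypass ≤ wlen wt p := by
  refine List.Sublist.sum_le_sum (p.edges_bypass_sublist_edges.map wt) fun a ha => ?_
  obtain ⟨e, he, rfl⟩ := List.mem_map.1 ha
  exact (hwt e (p.edges_subset_edgeSet he)).le

lemma wlen_take_add_wlen_drop {x y : V} (p : G.Walk x y) (n : ℕ) :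
    wlen wt (p.take n) + wlen wt (p.drop n) = wlen wt p := by
  simp only [wlen, Walk.edges_take, Walk.edges_drop, ← List.sum_append, ← List.map_append,
    List.take_append_drop]

lemma wlen_drop_drop {x y : V} (p : G.Walk x y) (n m : ℕ) :
    wlen wt ((p.drop n).drop m) = wlen wt (p.drop (n + m)) := by
  simp only [wlen, Walk.edges_drop, List.drop_drop]

lemma wlen_take_mono (hwt : ∀ e ∈ G.edgeSet, 0 < wt e) {x y : V} (p : G.Walk x y)
    {m n : ℕ} (h : m ≤ n) : wlen wt (p.take m) ≤ wlen wt (p.take n) := by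
  simp only [wlen, Walk.edges_take]
  refine List.Sublist.sum_le_sum (((List.take_prefix_take_left h).sublist).map wt)
    fun a ha => ?_
  obtain ⟨e, he, rfl⟩ := List.mem_map.1 ha
  exact (hwt e (p.edges_subset_edgeSet (List.mem_of_mem_take he))).le

lemma StaysIn.append {A : Set V} {x y z : V} {p : G.Walk x y} {q : G.Walk y z}
    (hp : StaysIn A p) (hq : StaysIn A q) : StaysIn A (p.append q) := by
  intro w hw
  rcases (Walk.mem_support_append_iff _ _).1 hw with h | h
  exacts [hp w h, hq w h]

lemma StaysIn.of_append {A : Set V} {x y z : V} {p : G.Walk x y} {q : G.Walk y z}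
    (h : StaysIn A (p.append q)) : StaysIn A p ∧ StaysIn A q :=
  ⟨fun w hw => h w ((Walk.mem_support_append_iff _ _).2 (.inl hw)),
    fun w hw => h w ((Walk.mem_support_append_iff _ _).2 (.inr hw))⟩

lemma StaysIn.reverse {A : Set V} {x y : V} {p : G.Walk x y} (h : StaysIn A p) :
    StaysIn A p.reverse := by
  intro w hw
  exact h w (by simpa using hw)

lemma StaysIn.mapLe {T : SimpleGraph V} (hT : T ≤ G) {A : Set V} {x y : V} {p : T.Walk x y}
    (h : StaysIn A p) : StaysIn A (p.mapLe hT) := by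
  intro w hw
  exact h w (by simpa using hw)

lemma StaysIn.take {A : Set V} {x y : V} {p : G.Walk x y} (h : StaysIn A p) (n : ℕ) :
    StaysIn A (p.take n) := by
  intro w hw
  rw [Walk.support_take] at hw
  exact h w (List.mem_of_mem_take hw)

lemma StaysIn.drop {A : Set V} {x y : V} {p : G.Walk x y} (h : StaysIn A p) (n : ℕ) :
    StaysIn A (p.drop n) := by
  intro w hw
  rw [Walk.drop_support_eq_support_drop_min] at hw
  exact h w (List.mem_of_mem_drop hw)

lemma wdist_le {A : Set V} {x y : V} (p : G.Walk x y) (hp : StaysIn A p) :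
    wdist G wt A x y ≤ ENNReal.ofReal (wlen wt p) :=
  iInf_le (fun p : {p : G.Walk x y // StaysIn A p} => ENNReal.ofReal (wlen wt p.1)) ⟨p, hp⟩

/-- A walk that enters a set `D` can be split at its first edge into `D`. -/
lemma exists_first_entry {D : Set V} {x y : V} (p : G.Walk x y) (hx : x ∉ D)
    (hD : ∃ z ∈ p.support, z ∈ D) :
    ∃ (w f : V) (q : G.Walk x w) (h : G.Adj w f) (r : G.Walk f y),
      f ∈ D ∧ StaysIn Dᶜ q ∧ p = q.append (Walk.cons h r) := by
  induction p with
  | nil =>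
    obtain ⟨z, hz, hzD⟩ := hD
    simp only [Walk.support_nil, List.mem_singleton] at hz
    exact absurd (hz ▸ hzD) hx
  | @cons a b c h r ih =>
    by_cases hb : b ∈ D
    · refine ⟨a, b, Walk.nil, h, r, hb, ?_, rfl⟩
      intro z hz
      simp only [Walk.support_nil, List.mem_singleton] at hz
      exact hz ▸ hx
    · obtain ⟨z, hz, hzD⟩ := hD
      have hz' : z ∈ r.support := by
        rw [Walk.support_cons, List.mem_cons] at hz
        exact hz.resolve_left fun e => hx (e ▸ hzD)
      obtain ⟨w, f, q, h', r', hf, hq, rfl⟩ := ih hb ⟨z, hz', hzD⟩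
      refine ⟨w, f, Walk.cons h q, h', r', hf, ?_, rfl⟩
      intro z' hz'
      rw [Walk.support_cons, List.mem_cons] at hz'
      rcases hz' with rfl | hz'
      exacts [hx, hq _ hz']

/-- If two vertices of a tree have depths whose sum is less than `M`, there are paths to the
root of total length less than `M`. -/
lemma exists_paths_of_depth_add_lt {T : SimpleGraph V} (hwt : ∀ e ∈ T.edgeSet, 0 < wt e)
    {r a b : V} {M : ℝ}
    (h : depth wt T r a + depth wt T r b < ENNReal.ofReal M) :
    ∃ (p : T.Walk a r) (q : T.Walk b r), p.IsPath ∧ q.IsPath ∧ wlen wt p + wlen wt q < M := by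
  classical
  by_contra! hcon
  refine h.not_ge (ENNReal.le_iInf_add_iInf fun p q => ?_)
  rw [← ENNReal.ofReal_add (wlen_nonneg hwt _) (wlen_nonneg hwt _)]
  refine ENNReal.ofReal_le_ofReal ?_
  have := hcon _ _ p.1.bypass_isPath q.1.bypass_isPath
  have := wlen_bypass_le hwt p.1
  have := wlen_bypass_le hwt q.1
  linarith

/-- If a walk shorter than `p` has the same ends, then every vertex of `p` has distance at most
`|p|` to every vertex of that walk. -/
lemma exists_walk_le_of_shorter {A : Set V} {x y z f : V}
    {p q : G.Walk x y} (hp : StaysIn A p) (hq : StaysIn A q) (hlt : wlen wt q < wlen wt p)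
    (hz : z ∈ p.support) (hf : f ∈ q.support) :
    ∃ W : G.Walk z f, StaysIn A W ∧ wlen wt W ≤ wlen wt p := by
  obtain ⟨p₁, p₂, rfl⟩ := Walk.mem_support_iff_exists_append.1 hz
  obtain ⟨q₁, q₂, rfl⟩ := Walk.mem_support_iff_exists_append.1 hf
  rw [wlen_append, wlen_append] at hlt
  -- The closed walk formed by `p` and `q` is shorter than `2|p|`, so the shorter of its two arcs
  -- from `z` to `f` has length at most `|p|`.
  rcases le_total (wlen wt p₁ + wlen wt q₁) (wlen wt p₂ + wlen wt q₂) with h | h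
  · refine ⟨p₁.reverse.append q₁, hp.of_append.1.reverse.append hq.of_append.1, ?_⟩
    rw [wlen_append, wlen_append, wlen_reverse]
    linarith
  · refine ⟨p₂.append q₂.reverse, hp.of_append.2.append hq.of_append.2.reverse, ?_⟩
    rw [wlen_append, wlen_append, wlen_reverse]
    linarith

/-- Replacing a part of a shortest path by a shorter walk leaves the ambient vertex set. -/
lemma IsShortestPathIn.exists_notMem_of_shorter {A : Set V} {u v : V} {P : G.Walk u v}
    (hP : IsShortestPathIn wt A P) (a l : ℕ)
    (q : G.Walk (P.getVert a) ((P.drop a).getVert l))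
    (hq : wlen wt q < wlen wt ((P.drop a).take l)) :
    ∃ f ∈ q.support, f ∉ A := by
  by_contra! h
  have := hP.2.2 ((P.take a).append (q.append ((P.drop a).drop l)))
    ((hP.2.1.take a).append (StaysIn.append h ((hP.2.1.drop a).drop l)))
  simp only [wlen_append] at this
  have h1 := wlen_take_add_wlen_drop (wt := wt) P a
  have h2 := wlen_take_add_wlen_drop (wt := wt) (P.drop a) l
  linarith

end WalkLength

/-! ### Lengths of segments -/

section Segments

/-- Reals with equal floors differ by less than `1`, and adding `1` to the logarithm multiplies by
the base. -/
lemma lt_one_add_mul_of_floor_logb_eq {δ x y : ℝ} (hδ : 0 < δ) (hx : 0 < x) (hy : 0 < y)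
    (h : ⌊Real.logb (1 + δ) x⌋ = ⌊Real.logb (1 + δ) y⌋) : y < (1 + δ) * x := by
  have h1 := Int.floor_le (Real.logb (1 + δ) x)
  have h2 := Int.lt_floor_add_one (Real.logb (1 + δ) y)
  rw [← h] at h2
  have hb : 1 < 1 + δ := by linarith
  rw [← Real.logb_lt_logb_iff hb hy (by positivity),
    Real.logb_mul (by positivity) hx.ne', Real.logb_self_eq_one hb]
  linarith

/-- A segment has length at most `δ` times the distance of each of its vertices to the nearer
end of the path. -/
lemma SameSegment.wlen_le {V : Type*} {G : SimpleGraph V} {wt : Sym2 V → ℝ}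
    (hwt : ∀ e ∈ G.edgeSet, 0 < wt e) {δ : ℝ} (hδ : 0 < δ) {u v : V} {P : G.Walk u v}
    {a b m : ℕ} (h : SameSegment wt δ P a b) (ham : a ≤ m) (hmb : m ≤ b) :
    wlen wt ((P.drop a).take (b - a)) ≤
      δ * min (wlen wt (P.take m)) (wlen wt (P.drop m)) := by
  obtain ⟨ha, haP, hb, hbP, h⟩ := h
  have e1 := wlen_take_add_wlen_drop (wt := wt) (P.drop a) (b - a)
  rw [wlen_drop_drop, Nat.add_sub_cancel' (ham.trans hmb)] at e1
  have ea := wlen_take_add_wlen_drop (wt := wt) P a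
  have eb := wlen_take_add_wlen_drop (wt := wt) P b
  have em := wlen_take_add_wlen_drop (wt := wt) P m
  have h1 := wlen_take_mono hwt P ham
  have h2 := wlen_take_mono hwt P hmb
  rcases h with ⟨-, hb2, hfl⟩ | ⟨ha2, -, hfl⟩
  -- In the first half the length is `|P[u,b]| - |P[u,a]| < δ|P[u,a]|`, and `a ≤ m`. The second half
  -- is symmetric, with `b` as the vertex nearer to its end.
  · have pa : 0 < wlen wt (P.take a) := wlen_pos hwt _ (by simp; omega)
    have := lt_one_add_mul_of_floor_logb_eq hδ pa (by linarith) hfl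
    rw [min_eq_left (by linarith)]
    nlinarith
  · have pb : 0 < wlen wt (P.drop b) := wlen_pos hwt _ (by simp; omega)
    have := lt_one_add_mul_of_floor_logb_eq hδ pb (by linarith) hfl.symm
    rw [min_eq_right (by linarith)]
    nlinarith

end Segments

/-! ### Levels of vertices -/

section Levels

variable {V : Type*} {U : ℕ → Set V} {p : ℕ}

lemma one_le_level (hp : 1 ≤ p) (h1 : U 1 = Set.univ) (z : V) : 1 ≤ level U p z := by
  classical
  exact Nat.le_findGreatest hp (by simp [h1])

lemma level_le (z : V) : level U p z ≤ p := by
  classical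
  exact Nat.findGreatest_le p

lemma mem_of_level (hp : 1 ≤ p) (h1 : U 1 = Set.univ) (z : V) : z ∈ U (level U p z) := by
  classical
  exact Nat.findGreatest_spec (P := fun l => z ∈ U l) hp (by simp [h1])

/-- This places `G_i` inside `G - U (i+1)`, the graph covered at level `i`. For `i = p` it rests on
the convention `U (p+1) = ∅`. -/
lemma notMem_succ_of_level_le (hlast : U (p + 1) = ∅) {z : V} {i : ℕ} (hi : i ≤ p)
    (h : level U p z ≤ i) : z ∉ U (i + 1) := by
  classical
  rcases hi.eq_or_lt with rfl | hlt
  · simp [hlast]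
  · exact Nat.findGreatest_is_greatest (P := fun l => z ∈ U l) (Nat.lt_succ_of_le h) hlt

end Levels

/-! ### Tree covers and nearby vertices of `V(H)` -/

section TreeCovers

variable {V : Type*} [Fintype V] {G : SimpleGraph V} {wt : Sym2 V → ℝ}

/-- In a tree of the cover that contains two sufficiently close vertices `a ∉ D` and `f ∈ D`,
the tree path from `a` towards `f` meets `V(H)` just before it enters `D`. -/
lemma exists_auxVert_near (hwt : ∀ e ∈ G.edgeSet, 0 < wt e)
    (𝒯 : ∀ R S : Set V, TreeCover G wt R S) (U : ℕ → Set V) {p i : ℕ} (hi : 1 ≤ i)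
    (hip : i ≤ p) {D : Set V} (s t : V) {a f : V} (ha : a ∈ U i \ U (i + 1)) (haD : a ∉ D)
    (hf : f ∈ D) {W : G.Walk a f} (hW : StaysIn (U (i + 1))ᶜ W) {L : ℝ} (hL : 0 < L)
    (hWL : wlen wt W ≤ L) (hk : 0 < 2 * kpar V - 1) :
    ∃ w ∈ auxVerts 𝒯 U p D s t,
      wdist G wt Dᶜ a w ≤ ENNReal.ofReal (2 * ((2 * kpar V - 1) * L)) := by
  have hdist := (wdist_le (wt := wt) W hW).trans (ENNReal.ofReal_le_ofReal hWL)
  obtain ⟨r, hr, haT, -, hdep⟩ := (𝒯 (U (i + 1)) (U i)).stretch a ha f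
    (hW f W.end_mem_support) (hdist.trans_lt ENNReal.ofReal_lt_top)
  have htree := (𝒯 (U (i + 1)) (U i)).isTree r hr
  set T := (𝒯 (U (i + 1)) (U i)).tree r with hT
  have hwtT : ∀ e ∈ T.edgeSet, 0 < wt e := fun e he => hwt e (edgeSet_mono htree.le he)
  -- Depths are infima, so a strict bound is needed to extract actual paths; the factor `2` provides
  -- it.
  have hM : depth wt T r a + depth wt T r f
      < ENNReal.ofReal (2 * ((2 * kpar V - 1) * L)) := by
    refine (hdep.trans (mul_le_mul_right hdist _)).trans_lt ?_
    rw [← ENNReal.ofReal_mul hk.le]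
    have := mul_pos hk hL
    exact (ENNReal.ofReal_lt_ofReal_iff (by linarith)).2 (by linarith)
  obtain ⟨pa, pf, hpa, hpf, hlen⟩ := exists_paths_of_depth_add_lt hwtT hM
  by_cases hpaD : ∃ z ∈ pa.support, z ∈ D
  -- On the way up, `w` is a child of `f'`, and a trunk vertex because it lies on the path between
  -- the sources `a` and `r`.
  · obtain ⟨w, f', q, hadj, q', hf', hq, rfl⟩ := exists_first_entry pa haD hpaD
    have hqr := wlen_nonneg hwtT (Walk.cons hadj q')
    have hpf0 := wlen_nonneg hwtT pf
    rw [wlen_append] at hlen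
    refine ⟨w, ⟨.inr (Set.mem_iUnion₂.2 ⟨f', hf', i, hi, hip, r, hr, ⟨q'.reverse⟩,
      .inr ⟨⟨hadj.symm, (Walk.cons hadj q').reverse, hpa.of_append_right.reverse, by simp⟩,
        ⟨(Walk.cons hadj q').reverse⟩, a, ha, r, hr, _, hpa, by simp⟩⟩), hq w q.end_mem_support⟩,
      (wdist_le _ (hq.mapLe htree.le)).trans (ENNReal.ofReal_le_ofReal ?_)⟩
    rw [wlen_mapLe]
    linarith
  · push Not at hpaD
    -- On the way down from the root, `w` is the parent of `f'`.
    obtain ⟨w, f', q, hadj, q', hf', hq, he⟩ := exists_first_entry pf.reverse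
      (hpaD r pa.end_mem_support) ⟨f, Walk.end_mem_support _, hf⟩
    have hlen' := congrArg (wlen wt) he
    rw [wlen_reverse, wlen_append] at hlen'
    have hqr := wlen_nonneg hwtT (Walk.cons hadj q')
    have he' : pf.reverse = (q.append (Walk.cons hadj Walk.nil)).append q' := by
      rw [he, ← Walk.append_assoc]
      rfl
    have hpath : (q.append (Walk.cons hadj Walk.nil)).IsPath :=
      Walk.IsPath.of_append_left (q := q') (he' ▸ hpf.reverse)
    refine ⟨w, ⟨.inr (Set.mem_iUnion₂.2 ⟨f', hf', i, hi, hip, r, hr,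
      ⟨q.append (Walk.cons hadj Walk.nil)⟩, .inl ⟨hadj, _, hpath, by simp⟩⟩),
      hq w q.end_mem_support⟩,
      (wdist_le (Walk.mapLe htree.le (pa.append q)) (StaysIn.mapLe htree.le
        (StaysIn.append hpaD hq))).trans (ENNReal.ofReal_le_ofReal ?_)⟩
    rw [wlen_mapLe, wlen_append]
    linarith

end TreeCovers

lemma one_lt_kpar {V : Type*} [Fintype V] (hn : 3 ≤ Fintype.card V) : 1 < kpar V := by
  have h3 : (3 : ℝ) ≤ Fintype.card V := by exact_mod_cast hn
  rw [kpar, Real.lt_log_iff_exp_lt (by linarith)]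
  linarith [Real.exp_one_lt_three]

end VSDO

/-! ### The main theorem -/

theorem mainTheorem2 {V : Type*} [Fintype V] (G : SimpleGraph V) (wt : Sym2 V → ℝ)
    (hwt : ∀ e ∈ G.edgeSet, 0 < wt e) (hn : 3 ≤ Fintype.card V)
    (d : ℕ) (hd : 2 ≤ d) (c : ℝ) (hc : 1 ≤ c)
    (𝒯 : ∀ R S : Set V, VSDO.TreeCover G wt R S)
    (U : ℕ → Set V) (p : ℕ) (hU : VSDO.IsHierarchyPath 𝒯 d c U p)
    (D : Set V) (hD : D.ncard ≤ d) (s t : V) (hs : s ∉ D) (ht : t ∉ D)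
    (ε ε₃ ε₄ : ℝ) (hε : 0 < ε)
    (hε₃ : ε₃ = ε / (2 * ((VSDO.auxVerts 𝒯 U p D s t).ncard : ℝ)))
    (hε₄ : ε₄ = ε₃ / (4 * VSDO.kpar V - 2))
    (u v : V) (hu : u ∈ VSDO.auxVerts 𝒯 U p D s t) (hv : v ∈ VSDO.auxVerts 𝒯 U p D s t)
    (P : G.Walk u v) (hP : VSDO.IsShortestPathIn wt Dᶜ P)
    (hfar : VSDO.IsFar wt D ε₃ (VSDO.auxVerts 𝒯 U p D s t) P) :
    VSDO.IsSegmentExpath wt U p ε₄ P := by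
  classical
  have hk := VSDO.one_lt_kpar hn
  have hcard : (0 : ℝ) < (VSDO.auxVerts 𝒯 U p D s t).ncard := by
    exact_mod_cast (Set.ncard_pos (Set.toFinite _)).2 ⟨u, hu⟩
  have hε₃pos : 0 < ε₃ := by rw [hε₃]; positivity
  have hε₄pos : 0 < ε₄ := by rw [hε₄]; exact div_pos hε₃pos (by linarith)
  -- The `4k - 2` in `ε₄` is the stretch `2k - 1` times the slack factor `2`.
  have hmul : 2 * ((2 * VSDO.kpar V - 1) * ε₄) = ε₃ := by
    have : 4 * VSDO.kpar V - 2 ≠ 0 := by linarith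
    rw [hε₄, ← mul_assoc, mul_div_assoc', div_eq_iff this]
    ring
  refine ⟨hP.1, fun a b hseg => ?_⟩
  set seg := (P.drop a).take (b - a) with hsegdef
  obtain ⟨z, hz, hmax⟩ := seg.support.toFinset.exists_max_image (VSDO.level U p)
    ⟨_, List.mem_toFinset.2 seg.start_mem_support⟩
  rw [List.mem_toFinset] at hz
  set i := VSDO.level U p z with hi
  have hi1 : 1 ≤ i := VSDO.one_le_level hU.one_le hU.root z
  have hip : i ≤ p := VSDO.level_le z
  have hsub : ∀ q ∈ VSDO.levelSet U p i, q ∈ (U (i + 1))ᶜ := fun q hq =>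
    VSDO.notMem_succ_of_level_le hU.last hip hq
  have hstay : VSDO.StaysIn (VSDO.levelSet U p i) seg := fun y hy =>
    hmax y (List.mem_toFinset.2 hy)
  refine ⟨i, hi1, hip, (hP.1.drop a).take _, hstay, fun q hq => ?_⟩
  by_contra! hlt
  obtain ⟨f, hfq, hf⟩ := hP.exists_notMem_of_shorter a (b - a) q hlt
  rw [Set.mem_compl_iff, not_not] at hf
  have hL : 0 < VSDO.wlen wt seg := (VSDO.wlen_nonneg hwt q).trans_lt hlt
  obtain ⟨W, hW, hWL⟩ := VSDO.exists_walk_le_of_shorter (fun y hy => hsub y (hstay y hy))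
    (fun y hy => hsub y (hq y hy)) hlt hz hfq
  have hzD : z ∈ Dᶜ := ((hP.2.1.drop a).take (b - a)) z hz
  obtain ⟨w, hw, hzw⟩ := VSDO.exists_auxVert_near hwt 𝒯 U hi1 hip s t
    ⟨VSDO.mem_of_level hU.one_le hU.root z, hsub z (hstay z hz)⟩ hzD hf hW hL hWL (by linarith)
  obtain ⟨l, hl, hlle⟩ := SimpleGraph.Walk.mem_support_iff_exists_getVert.1 hz
  obtain ⟨ha, haP, hb, hbP, -⟩ := hseg.1
  have hab : a ≤ b := (hseg.2 b hseg.1).1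
  rw [SimpleGraph.Walk.take_length, SimpleGraph.Walk.drop_length] at hlle
  rw [hsegdef, SimpleGraph.Walk.take_getVert, SimpleGraph.Walk.drop_getVert] at hl
  have hm1 : a ≤ a + (b - a) ⊓ l := by omega
  have hm2 : a + (b - a) ⊓ l ≤ b := by omega
  -- This is the index of `z` on `P`; it is interior because `a` and `b` are.
  refine hfar ⟨a + (b - a) ⊓ l, by omega, by omega, w, hw, ?_⟩
  rw [← hl] at hzw
  refine hzw.trans (ENNReal.ofReal_le_ofReal ?_)
  have hle := hseg.1.wlen_le hwt hε₄pos hm1 hm2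
  rw [← hmul]
  have := mul_le_mul_of_nonneg_left hle (by linarith : 0 ≤ 2 * (2 * VSDO.kpar V - 1))
  linarith
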